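/- **Theorem 2.1.** (a) Let $K$ be an ordinary differential field with derivation $a\mapsto a'$, let $D=K[d]$ be the (in general non-commutative) ring of differential operators $\sum_i a_i d^i$ with $d\,a=a\,d+a'$ for $a \in K$, and let $\mathcal D_1\in D^{p\times m}$ be any matrix of operators, defining the linear control system $\mathcal D_1\eta=0$ in the $m$ unknowns (inputs and outputs) $\eta$ and one independent variable ($n=1$). An *observable* is an element of the left $D$-module $M=D^{1\times m}/D^{1\times p}\mathcal D_1$, i.e. a linear combination of the unknowns and their derivatives modulo the equations of the system. The system is *controllable* if $0$ is the only observable $z$ with $Pz=0$ for some nonzero $P\in D$, i.e. if no nonzero observable satisfies by itself a nontrivial ordinary differential equation. It is *parametrizable* if there are $l\ge 0$ and an operator $\mathcal D\in D^{m\times l}$ such that $\mathcal D_1$ generates the compatibility conditions of $\mathcal D\xi=\eta$, i.e. $$\{\,r\in D^{1\times m} : r\,\mathcal D=0\,\}=D^{1\times p}\mathcal D_1 .$$ Then the system is controllable if and only if it is parametrizable. (b) Let $\mathcal D_1\in\mathbb R[d]^{p\times m}$ be a matrix of operators with constant real coefficients, acting on functions of time $t\in\mathbb R$ through $d=d/dt$.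 Then the following are equivalent: 1. for any two solutions $w_1,w_2\in C^\infty(\mathbb R,\mathbb R^m)$ of $\mathcal D_1w=0$ there are $T\ge 0$ and a solution $w\in C^\infty(\mathbb R,\mathbb R^m)$ of $\mathcal D_1w=0$ with $w(t)=w_1(t)$ for $t\le 0$ and $w(t)=w_2(t-T)$ for $t\ge T$; 2. there are $l\ge 0$ and $\mathcal D\in\mathbb R[d]^{m\times l}$ such that $\{\eta\in C^\infty(\mathbb R,\mathbb R^m):\mathcal D_1\eta=0\}=\{\mathcal D\xi:\xi\in C^\infty(\mathbb R,\mathbb R^l)\}$; 3. the system $\mathcal D_1\eta=0$ is controllable in the sense of (a), with $\mathbb R[d]$ in place of $D$; 4. there are $l\ge 0$ and $\mathcal D\in\mathbb R[d]^{m\times l}$ such that $\mathcal D_1$ generates the compatibility conditions of $\mathcal D$, in the sense of (a), with $\mathbb R[d]$ in place of $D$. -/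

import Mathlib

open Polynomial
open scoped ContDiff

universe u

noncomputable section

/-- The ring `D = K[d]` of ordinary differential operators `a₀ + a₁ d + ⋯ + aₙ dⁿ` with coefficients
in a differential field `K`. Only the underlying additive group is that of the polynomials
(the coefficient of `dⁱ` is stored as the coefficient of `Xⁱ`); the multiplication is the
composition of operators, defined below, with `d a = a d + a′`. -/
def DiffOp (K : Type u) [Field K] : Type u := K[X]

namespace DiffOp

section

variable {K : Type u} [Field K]

instance : AddCommGroup (DiffOp K) := inferInstanceAs (AddCommGroup K[X])

instance : One (DiffOp K) := inferInstanceAs (One K[X])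

/-- The multiplication operator `a`, of order zero. -/
def coeff (a : K) : DiffOp K := (C a : K[X])

/-- The operator `d`. -/
def d : DiffOp K := (X : K[X])

variable [Differential K]

/-- Left composition with `d`: `∑ bⱼ dʲ ↦ ∑ (bⱼ′ dʲ + bⱼ dʲ⁺¹)`. -/
def dComp : K[X] →+ K[X] where
  toFun Q := Q.sum (fun j b => monomial j (Differential.deriv b) + monomial (j + 1) b)
  map_zero' := by simp
  map_add' P Q := by
    refine Polynomial.sum_add_index P Q _ (by simp) ?_
    intro j a b
    simp only [map_add]
    abel

theorem dComp_monomial (j : ℕ) (b : K) :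
    dComp (monomial j b) = monomial j (Differential.deriv b) + monomial (j + 1) b := by
  simp [dComp, Polynomial.sum_monomial_index]

/-- Composition of operators, `(∑ aᵢ dⁱ) ∘ Q = ∑ aᵢ (dⁱ ∘ Q)`, as a biadditive map. -/
def comp : K[X] →+ K[X] →+ K[X] where
  toFun P :=
    { toFun := fun Q => P.sum (fun i a => C a * dComp^[i] Q)
      map_zero' := by simp [Polynomial.sum_def, iterate_map_zero]
      map_add' := fun Q S => by
        simp only [Polynomial.sum_def, ← Finset.sum_add_distrib]
        refine Finset.sum_congr rfl fun i _ => ?_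
        rw [iterate_map_add dComp i Q S, mul_add] }
  map_zero' := by
    refine AddMonoidHom.ext fun Q => ?_
    simp
  map_add' P S := by
    refine AddMonoidHom.ext fun Q => ?_
    refine Polynomial.sum_add_index P S (fun i a => C a * dComp^[i] Q) (fun i => ?_) ?_
    · simp
    · intro i a b
      simp only [map_add, add_mul]

theorem comp_monomial (i : ℕ) (a : K) (Q : K[X]) :
    comp (monomial i a) Q = C a * dComp^[i] Q := by
  simp [comp, Polynomial.sum_monomial_index]

theorem comp_C_mul (a : K) (P Q : K[X]) : comp (C a * P) Q = C a * comp P Q := by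
  induction P using Polynomial.induction_on' with
  | add P S hP hS => simp only [mul_add, map_add, AddMonoidHom.add_apply, hP, hS]
  | monomial i b => rw [C_mul_monomial, comp_monomial, comp_monomial, C_mul, mul_assoc]

theorem dComp_C_mul (a : K) (Q : K[X]) :
    dComp (C a * Q) = C (Differential.deriv a) * Q + C a * dComp Q := by
  induction Q using Polynomial.induction_on' with
  | add P S hP hS => simp only [mul_add, map_add, hP, hS]; abel
  | monomial i b =>
    simp only [C_mul_monomial, dComp_monomial, mul_add, Derivation.leibniz, smul_eq_mul, map_add]
    rw [mul_comm b]
    abel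

theorem comp_dComp (P Q : K[X]) : comp (dComp P) Q = dComp (comp P Q) := by
  induction P using Polynomial.induction_on' with
  | add P S hP hS => simp only [map_add, AddMonoidHom.add_apply, hP, hS]
  | monomial i b =>
    simp only [dComp_monomial, map_add, AddMonoidHom.add_apply, comp_monomial, dComp_C_mul,
      Function.iterate_succ_apply']

theorem comp_iterate_dComp (i : ℕ) (P Q : K[X]) :
    comp (dComp^[i] P) Q = dComp^[i] (comp P Q) := by
  induction i with
  | zero => rfl
  | succ i ih => rw [Function.iterate_succ_apply', comp_dComp, ih, Function.iterate_succ_apply']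

theorem comp_assoc (P Q S : K[X]) : comp (comp P Q) S = comp P (comp Q S) := by
  induction P using Polynomial.induction_on' with
  | add P T hP hT => simp only [map_add, AddMonoidHom.add_apply, hP, hT]
  | monomial i b => rw [comp_monomial, comp_C_mul, comp_iterate_dComp, comp_monomial]

theorem one_comp (Q : K[X]) : comp 1 Q = Q := by
  rw [← monomial_zero_one, comp_monomial]; simp

theorem iterate_dComp_one (i : ℕ) : dComp^[i] (1 : K[X]) = monomial i 1 := by
  induction i with
  | zero => rfl
  | succ i ih => rw [Function.iterate_succ_apply', ih, dComp_monomial]; simp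

theorem comp_one (P : K[X]) : comp P 1 = P := by
  induction P using Polynomial.induction_on' with
  | add P T hP hT => simp only [map_add, AddMonoidHom.add_apply, hP, hT]
  | monomial i b => rw [comp_monomial, iterate_dComp_one, C_mul_monomial, mul_one]

instance : Mul (DiffOp K) := ⟨fun P Q => comp P Q⟩

instance : Ring (DiffOp K) :=
  { (inferInstance : AddCommGroup (DiffOp K)), (inferInstance : One (DiffOp K)),
    (inferInstance : Mul (DiffOp K)) with
    left_distrib := fun P Q S => map_add (comp P) Q S
    right_distrib := fun P Q S => DFunLike.congr_fun (map_add comp P Q) S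
    zero_mul := fun Q => DFunLike.congr_fun (map_zero comp) Q
    mul_zero := fun P => map_zero (comp P)
    mul_assoc := comp_assoc
    one_mul := one_comp
    mul_one := comp_one }

/-- The commutation rule of `K[d]`. -/
theorem d_mul_coeff (a : K) : d * coeff a = coeff a * d + coeff (Differential.deriv a) := by
  change comp (X : K[X]) (C a) = comp (C a) X + C (Differential.deriv a)
  have h : dComp (C a : K[X]) = C (Differential.deriv a) + monomial 1 a := dComp_monomial 0 a
  rw [← monomial_one_one_eq_X, comp_monomial, show comp (C a) (monomial 1 (1 : K)) =
    C a * monomial 1 1 from comp_monomial 0 a _, Function.iterate_one, h, C_mul_monomial]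
  simp [_root_.add_comm (C (Differential.deriv a))]

end

end DiffOp

section

variable {A : Type u} [Ring A] {p m l : ℕ}

/-- The left module of observables of the linear system `R η = 0` over the ring `A` of operators:
all operators `η ↦ ∑ⱼ zⱼ ηⱼ`, modulo the left `A`-linear combinations of the equations. -/
abbrev Observable (R : Matrix (Fin p) (Fin m) A) : Type u :=
  (Fin m → A) ⧸ Submodule.span A (Set.range R.row)

/-- An observable is autonomous if it satisfies, by itself, a nonzero differential equation. -/
def IsAutonomous {R : Matrix (Fin p) (Fin m) A} (z : Observable R) : Prop :=
  ∃ P : A, P ≠ 0 ∧ P • z = 0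

/-- The control system `R η = 0` is controllable if it has no nonzero autonomous observable. -/
def IsControllable (R : Matrix (Fin p) (Fin m) A) : Prop :=
  ∀ z : Observable R, IsAutonomous z → z = 0

/-- The operator `R` generates the compatibility conditions of the operator `D : ξ ↦ η`: a row `r`
of operators is a compatibility condition of `D ξ = η`, i.e. `r ∘ D = 0`, if and only if it is
a left linear combination of the rows of `R`. -/
def GeneratesCC (R : Matrix (Fin p) (Fin m) A) (D : Matrix (Fin m) (Fin l) A) : Prop :=
  ∀ r : Fin m → A, Matrix.vecMul r D = 0 ↔ r ∈ Submodule.span A (Set.range R.row)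

/-- The system `R η = 0` is parametrizable: `R` generates the compatibility conditions of
some operator `D`. -/
def IsParametrizable (R : Matrix (Fin p) (Fin m) A) : Prop :=
  ∃ (l : ℕ) (D : Matrix (Fin m) (Fin l) A), GeneratesCC R D

end

section

variable {p m l : ℕ}

/-- The action of the constant coefficient operator `P = ∑ aᵢ dⁱ` on a function of time
(used only for smooth functions). -/
def applyOp (P : ℝ[X]) (f : ℝ → ℝ) (t : ℝ) : ℝ :=
  P.sum (fun i a => a * iteratedDeriv i f t)

/-- The action of a matrix of constant coefficient operators. -/
def applyMat (R : Matrix (Fin p) (Fin m) ℝ[X]) (w : Fin m → ℝ → ℝ) : Fin p → ℝ → ℝ :=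
  fun i t => ∑ j, applyOp (R i j) (w j) t

/-- The smooth trajectories of the system `R w = 0`, defined for all times. -/
def trajectories (R : Matrix (Fin p) (Fin m) ℝ[X]) : Set (Fin m → ℝ → ℝ) :=
  {w | (∀ j, ContDiff ℝ ∞ (w j)) ∧ applyMat R w = 0}

/-- Controllability in terms of trajectories: the past of any trajectory up to time `0` can be
steered, within the system and in finite time, to any other (time-shifted) trajectory. -/
def IsSteerable (R : Matrix (Fin p) (Fin m) ℝ[X]) : Prop :=
  ∀ w₁ ∈ trajectories R, ∀ w₂ ∈ trajectories R,
    ∃ T : ℝ, 0 ≤ T ∧ ∃ w ∈ trajectories R,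
      (∀ j, ∀ t ≤ 0, w j t = w₁ j t) ∧ (∀ j, ∀ t ≥ T, w j t = w₂ j (t - T))

/-- `D` parametrizes the trajectories of `R η = 0`: these are exactly the functions `D ξ`
with `ξ` smooth and arbitrary. -/
def ParametrizesTrajectories (R : Matrix (Fin p) (Fin m) ℝ[X])
    (D : Matrix (Fin m) (Fin l) ℝ[X]) : Prop :=
  trajectories R = {η | ∃ ξ : Fin l → ℝ → ℝ, (∀ k, ContDiff ℝ ∞ (ξ k)) ∧ η = applyMat D ξ}

end

end

/-! Let `N` be the row module of `R`. Controllability says that the quotient by `N` is torsion-free;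
parametrizability says that `N` is the kernel of right multiplication by a matrix, so that the
quotient embeds in a free module. Over a domain the second implies the first. The converse holds
over any two-sided Ore domain (`exists_ker_eq_of_saturated`), and `K[d]` is one because it has
division with remainder on both sides.

For constant coefficients, a finitely generated torsion-free module over the PID `ℝ[X]` is free, so
the parametrization `D` can be chosen with a left inverse modulo `N`. Then every trajectory is some
`D ξ`, and a cutoff applied to the free functions `ξ` steers one trajectory to another. The way back
to algebra uses two facts: a row outside `N` is nonzero on some trajectory (`exists_pair_ne_zero`),
and an autonomous observable vanishing on an interval is zero (`eq_zero_of_aeval_eq_zero`), so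
steering to rest kills it. -/

/-! ### Ore domains and torsion-free quotients. -/

section Ore

/-- Every two elements, the second one nonzero, have a common left multiple with nonzero
left cofactor. -/
def IsLeftOre (A : Type u) [Ring A] : Prop :=
  ∀ a g : A, g ≠ 0 → ∃ s q : A, s ≠ 0 ∧ s * a = q * g

/-- Every two elements, the second one nonzero, have a common right multiple with nonzero
right cofactor. -/
def IsRightOre (A : Type u) [Ring A] : Prop :=
  ∀ a g : A, g ≠ 0 → ∃ s q : A, s ≠ 0 ∧ a * s = g * q

variable {A : Type u} [Ring A]

/-- A common right denominator: formally `g⁻¹ (a k) = (q k) s⁻¹` with the same `s` for all `k`. -/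
theorem IsRightOre.exists_common [NoZeroDivisors A] [Nontrivial A] (hA : IsRightOre A)
    {l : ℕ} (a : Fin l → A) {g : A} (hg : g ≠ 0) :
    ∃ (s : A) (q : Fin l → A), s ≠ 0 ∧ ∀ k, a k * s = g * q k := by
  induction l with
  | zero => exact ⟨1, Fin.elim0, one_ne_zero, fun k => k.elim0⟩
  | succ l ih =>
    obtain ⟨s, q, hs, h⟩ := ih (Fin.tail a)
    obtain ⟨t, c, ht, hc⟩ := hA (a 0 * s) g hg
    refine ⟨s * t, Fin.cons c fun k => q k * t, mul_ne_zero hs ht, Fin.cases ?_ fun k => ?_⟩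
    · rw [Fin.cons_zero, ← mul_assoc, hc]
    · rw [Fin.cons_succ, ← mul_assoc, ← mul_assoc, ← h k]; rfl

/-- Over an Ore domain, a submodule of `A^m` with torsion-free quotient is the kernel of a
linear map between free modules. -/
theorem exists_ker_eq_of_saturated [NoZeroDivisors A] [Nontrivial A] (hl : IsLeftOre A)
    (hr : IsRightOre A) {m : ℕ} (N : Submodule A (Fin m → A))
    (hN : ∀ (P : A) (r : Fin m → A), P ≠ 0 → P • r ∈ N → r ∈ N) :
    ∃ (l : ℕ) (f : (Fin m → A) →ₗ[A] (Fin l → A)), LinearMap.ker f = N := by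
  induction m with
  | zero => exact ⟨0, 0, Subsingleton.elim _ _⟩
  | succ m ih =>
    let ι : (Fin m → A) →ₗ[A] (Fin (m + 1) → A) :=
      { toFun := fun x => Fin.cons 0 x
        map_add' := fun x y => by ext i; refine Fin.cases ?_ (fun j => ?_) i <;> simp
        map_smul' := fun c x => by ext i; refine Fin.cases ?_ (fun j => ?_) i <;> simp }
    let τ : (Fin (m + 1) → A) →ₗ[A] (Fin m → A) := LinearMap.funLeft A A Fin.succ
    have hι : ∀ r : Fin (m + 1) → A, r 0 = 0 → ι (τ r) = r := fun r h => by
      ext i; refine Fin.cases ?_ (fun j => ?_) i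
      · exact h.symm
      · rfl
    obtain ⟨l, f, hf⟩ := ih (N.comap ι) fun P r hP h => hN P (ι r) hP (by simpa using h)
    -- If coordinate 0 vanishes on `N`, it is itself one more equation; otherwise it can be
    -- eliminated by means of an element of `N`.
    by_cases h0 : ∀ n ∈ N, n 0 = 0
    · let F : (Fin (m + 1) → A) →ₗ[A] (Fin (l + 1) → A) :=
        { toFun := fun r => Fin.cons (r 0) (f (τ r))
          map_add' := fun x y => by ext i; refine Fin.cases ?_ (fun j => ?_) i <;> simp
          map_smul' := fun c x => by ext i; refine Fin.cases ?_ (fun j => ?_) i <;> simp }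
      refine ⟨l + 1, F, Submodule.ext fun r => ?_⟩
      have key : F r = 0 ↔ r 0 = 0 ∧ f (τ r) = 0 := by
        constructor
        · intro h
          exact ⟨congrFun h 0, funext fun k => congrFun h k.succ⟩
        · rintro ⟨h1, h2⟩
          ext i; refine Fin.cases ?_ (fun j => ?_) i
          · exact h1
          · exact congrFun h2 j
      rw [LinearMap.mem_ker, key]
      have h1 : f (τ r) = 0 ↔ ι (τ r) ∈ N := by
        rw [← LinearMap.mem_ker, hf, Submodule.mem_comap]
      rw [h1]
      constructor
      · rintro ⟨h2, h3⟩; rwa [hι r h2] at h3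
      · intro h; exact ⟨h0 r h, by rwa [hι r (h0 r h)]⟩
    · push Not at h0
      obtain ⟨n, hn, hg⟩ := h0
      -- Formally `F r = (f (τ r) - r₀ n₀⁻¹ f (τ n)) s`: the choice of `b` makes `F n = 0`, and all
      -- factors sit on the right to keep `F` left linear.
      obtain ⟨s, b, hs, hb⟩ := hr.exists_common (f (τ n)) hg
      let F : (Fin (m + 1) → A) →ₗ[A] (Fin l → A) :=
        { toFun := fun r k => f (τ r) k * s - r 0 * b k
          map_add' := fun x y => by ext k; simp [add_mul]; abel
          map_smul' := fun c x => by ext k; simp [mul_assoc, mul_sub] }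
      have hFn : F n = 0 := funext fun k => by simp [F, hb k]
      have hF0 : ∀ r : Fin (m + 1) → A, r 0 = 0 → (F r = 0 ↔ r ∈ N) := fun r h => by
        have h1 : F r = 0 ↔ f (τ r) = 0 := by
          simp [F, funext_iff, h, hs]
        rw [h1, ← LinearMap.mem_ker, hf, Submodule.mem_comap, hι r h]
      refine ⟨l, F, Submodule.ext fun r => ?_⟩
      -- `P • r - Q • n` has zero coordinate 0, where `ker F` is already known to agree with `N`;
      -- then `P` is cancelled, by saturation of `N` or in the domain `A`.
      obtain ⟨P, Q, hP, hPQ⟩ := hl (r 0) (n 0) hg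
      have h2 := hF0 (P • r - Q • n) (by simp [hPQ])
      rw [map_sub, map_smul, map_smul, hFn, smul_zero, sub_zero,
        Submodule.sub_mem_iff_left N (N.smul_mem Q hn)] at h2
      rw [LinearMap.mem_ker]
      constructor
      · intro h; exact hN P r hP (h2.1 (by rw [h, smul_zero]))
      · intro h
        have h3 := h2.2 (N.smul_mem P h)
        funext k
        have h4 : P * F r k = 0 := congrFun h3 k
        exact (mul_eq_zero.1 h4).resolve_left hP

theorem Matrix.vecMul_toMatrixRight' {m l : ℕ} (f : (Fin m → A) →ₗ[A] (Fin l → A))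
    (r : Fin m → A) : Matrix.vecMul r (LinearMap.toMatrixRight' f) = f r :=
  LinearMap.congr_fun (LinearEquiv.apply_symm_apply Matrix.toLinearMapRight' f) r

variable {p m : ℕ}

theorem isControllable_iff (R : Matrix (Fin p) (Fin m) A) :
    IsControllable R ↔ ∀ (P : A) (r : Fin m → A), P ≠ 0 →
      P • r ∈ Submodule.span A (Set.range R.row) → r ∈ Submodule.span A (Set.range R.row) := by
  constructor
  · intro h P r hP hr
    rw [← Submodule.Quotient.mk_eq_zero]
    refine h _ ⟨P, hP, ?_⟩
    rwa [← Submodule.Quotient.mk_smul, Submodule.Quotient.mk_eq_zero]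
  · rintro h z ⟨P, hP, hz⟩
    obtain ⟨r, rfl⟩ := Submodule.Quotient.mk_surjective _ z
    rw [← Submodule.Quotient.mk_smul, Submodule.Quotient.mk_eq_zero] at hz
    exact (Submodule.Quotient.mk_eq_zero _).2 (h P r hP hz)

theorem IsParametrizable.isControllable [NoZeroDivisors A] {R : Matrix (Fin p) (Fin m) A}
    (h : IsParametrizable R) : IsControllable R := by
  obtain ⟨l, D, hD⟩ := h
  refine (isControllable_iff R).2 fun P r hP hr => ?_
  rw [← hD, Matrix.smul_vecMul] at hr
  rw [← hD]
  exact (smul_eq_zero.1 hr).resolve_left hP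

theorem IsControllable.isParametrizable [NoZeroDivisors A] [Nontrivial A] (hl : IsLeftOre A)
    (hr : IsRightOre A) {R : Matrix (Fin p) (Fin m) A} (h : IsControllable R) :
    IsParametrizable R := by
  obtain ⟨l, f, hf⟩ := exists_ker_eq_of_saturated hl hr _ ((isControllable_iff R).1 h)
  refine ⟨l, LinearMap.toMatrixRight' f, fun r => ?_⟩
  rw [← hf, LinearMap.mem_ker, Matrix.vecMul_toMatrixRight']

/-- A ring with a degree allowing division with remainder by left multiples is left Ore. -/
theorem isLeftOre_of_division [NoZeroDivisors A] [Nontrivial A] {α : Type*} [Preorder α]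
    [WellFoundedLT α] (deg : A → α)
    (hdiv : ∀ a b : A, b ≠ 0 → ∃ q, deg (a - q * b) < deg b) : IsLeftOre A := by
  intro a g
  induction hd : deg g using WellFoundedLT.induction generalizing a g with
  | ind n ih =>
    intro hg
    obtain ⟨q, hq⟩ := hdiv a g hg
    by_cases h0 : a - q * g = 0
    · exact ⟨1, q, one_ne_zero, by rw [one_mul, sub_eq_zero.1 h0]⟩
    -- Euclid: induction on the pair (`g`, remainder) gives `s * g = t * (a - q * g)`, hence `t * a
    -- = (s + t * q) * g`.
    · obtain ⟨s, t, hs, h⟩ := ih _ (hd ▸ hq) g _ rfl h0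
      refine ⟨t, s + t * q, ?_, ?_⟩
      · rintro rfl
        exact mul_ne_zero hs hg (by rw [h, zero_mul])
      · rw [add_mul, h]; noncomm_ring

/-- A ring with a degree allowing division with remainder by right multiples is right Ore. -/
theorem isRightOre_of_division [NoZeroDivisors A] [Nontrivial A] {α : Type*} [Preorder α]
    [WellFoundedLT α] (deg : A → α)
    (hdiv : ∀ a b : A, b ≠ 0 → ∃ q, deg (a - b * q) < deg b) : IsRightOre A := by
  intro a g
  induction hd : deg g using WellFoundedLT.induction generalizing a g with
  | ind n ih =>
    intro hg
    obtain ⟨q, hq⟩ := hdiv a g hg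
    by_cases h0 : a - g * q = 0
    · exact ⟨1, q, one_ne_zero, by rw [mul_one, sub_eq_zero.1 h0]⟩
    · obtain ⟨s, t, hs, h⟩ := ih _ (hd ▸ hq) g _ rfl h0
      refine ⟨t, s + q * t, ?_, ?_⟩
      · rintro rfl
        exact mul_ne_zero hg hs (by rw [h, mul_zero])
      · rw [mul_add, h]; noncomm_ring

end Ore

/-! ### Orders of operators and two-sided division in `K[d]`. -/

namespace DiffOp

variable {K : Type u} [Field K] [Differential K]

theorem coeff_dComp_succ (Q : K[X]) (n : ℕ) :
    (dComp Q).coeff (n + 1) = Differential.deriv (Q.coeff (n + 1)) + Q.coeff n := by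
  induction Q using Polynomial.induction_on' with
  | add P S hP hS => simp only [map_add, coeff_add, hP, hS]; abel
  | monomial i b =>
    simp only [dComp_monomial, Polynomial.coeff_add, coeff_monomial, add_left_inj]
    split_ifs <;> simp

/-- Each composition with `d` raises the order by one and keeps the top coefficient, since the
derivative terms stay in lower order. -/
theorem coeff_iterate_dComp {Q : K[X]} {j : ℕ} (hQ : ∀ n, j < n → Q.coeff n = 0) (i : ℕ) :
    (∀ n, i + j < n → (dComp^[i] Q).coeff n = 0) ∧
      (dComp^[i] Q).coeff (i + j) = Q.coeff j := by
  induction i with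
  | zero => simpa using hQ
  | succ i ih =>
    simp only [Function.iterate_succ_apply']
    refine ⟨fun n hn => ?_, ?_⟩
    · obtain ⟨k, rfl⟩ : ∃ k, n = k + 1 := ⟨n - 1, by omega⟩
      rw [coeff_dComp_succ, ih.1 _ (by omega), ih.1 _ (by omega)]; simp
    · rw [show i + 1 + j = i + j + 1 by omega, coeff_dComp_succ, ih.1 _ (by omega), ih.2]; simp

theorem coeff_comp (P Q : K[X]) (n : ℕ) :
    (comp P Q).coeff n = ∑ i ∈ Finset.range (P.natDegree + 1),
      P.coeff i * (dComp^[i] Q).coeff n := by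
  conv_lhs => rw [P.as_sum_range' (P.natDegree + 1) (by omega), map_sum,
    AddMonoidHom.finsetSum_apply]
  simp [comp_monomial]

theorem coeff_comp_of_lt {P Q : K[X]} {n : ℕ} (hn : P.natDegree + Q.natDegree < n) :
    (comp P Q).coeff n = 0 := by
  rw [coeff_comp]
  refine Finset.sum_eq_zero fun i hi => ?_
  rw [(coeff_iterate_dComp (fun k hk => coeff_eq_zero_of_natDegree_lt hk) i).1 n
    (by rw [Finset.mem_range] at hi; omega), mul_zero]

theorem coeff_comp_natDegree_add (P Q : K[X]) :
    (comp P Q).coeff (P.natDegree + Q.natDegree) = P.leadingCoeff * Q.leadingCoeff := by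
  rw [coeff_comp, Finset.sum_range_succ, Finset.sum_eq_zero fun i hi => ?_, zero_add,
    (coeff_iterate_dComp (fun k hk => coeff_eq_zero_of_natDegree_lt hk) _).2]
  · rfl
  · rw [(coeff_iterate_dComp (fun k hk => coeff_eq_zero_of_natDegree_lt hk) i).1 _
      (by rw [Finset.mem_range] at hi; omega), mul_zero]

theorem comp_ne_zero {P Q : K[X]} (hP : P ≠ 0) (hQ : Q ≠ 0) : comp P Q ≠ 0 := by
  intro h
  have := coeff_comp_natDegree_add P Q
  rw [h, Polynomial.coeff_zero] at this
  exact mul_ne_zero (leadingCoeff_ne_zero.2 hP) (leadingCoeff_ne_zero.2 hQ) this.symm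

instance : NoZeroDivisors (DiffOp K) where
  eq_zero_or_eq_zero_of_mul_eq_zero {P Q} h := by
    by_contra! hne
    exact comp_ne_zero (K := K) hne.1 hne.2 h

instance : Nontrivial (DiffOp K) := inferInstanceAs (Nontrivial K[X])

/-- Leading coefficients multiply in the commutative field `K`, so the same monomial quotient
cancels the top term on either side. -/
theorem degree_sub_comp_lt {P Q a : K[X]} (ha : a ≠ 0)
    (hdeg : P.natDegree + Q.natDegree = a.natDegree)
    (hlc : P.leadingCoeff * Q.leadingCoeff = a.leadingCoeff) :
    (a - comp P Q).degree < a.degree := by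
  rw [degree_eq_natDegree ha, degree_lt_iff_coeff_zero]
  intro n hn
  rw [coeff_sub]
  rcases hn.eq_or_lt with rfl | hn
  · rw [← hdeg, coeff_comp_natDegree_add, hlc, hdeg]; exact sub_self _
  · rw [coeff_comp_of_lt (by omega), coeff_eq_zero_of_natDegree_lt hn, sub_zero]

theorem exists_degree_sub_comp_left_lt (a : K[X]) {b : K[X]} (hb : b ≠ 0) :
    ∃ q, (a - comp q b).degree < b.degree := by
  induction hd : a.degree using WellFoundedLT.induction generalizing a with
  | ind n ih =>
    by_cases h : a.degree < b.degree
    · exact ⟨0, by simpa using h⟩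
    · have ha : a ≠ 0 := by rintro rfl; exact h (by simpa [bot_lt_iff_ne_bot] using hb)
      have hle : b.natDegree ≤ a.natDegree := natDegree_le_natDegree (not_lt.1 h)
      have hc : a.leadingCoeff / b.leadingCoeff ≠ 0 :=
        div_ne_zero (leadingCoeff_ne_zero.2 ha) (leadingCoeff_ne_zero.2 hb)
      let c : K[X] := monomial (a.natDegree - b.natDegree) (a.leadingCoeff / b.leadingCoeff)
      have hlt : (a - comp c b).degree < a.degree := by
        refine degree_sub_comp_lt ha ?_ ?_
        · rw [natDegree_monomial_eq _ hc]; omega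
        · rw [leadingCoeff_monomial, div_mul_cancel₀ _ (leadingCoeff_ne_zero.2 hb)]
      obtain ⟨q, hq⟩ := ih _ (hd ▸ hlt) _ rfl
      refine ⟨c + q, ?_⟩
      rwa [map_add, AddMonoidHom.add_apply, ← sub_sub]

theorem exists_degree_sub_comp_right_lt (a : K[X]) {b : K[X]} (hb : b ≠ 0) :
    ∃ q, (a - comp b q).degree < b.degree := by
  induction hd : a.degree using WellFoundedLT.induction generalizing a with
  | ind n ih =>
    by_cases h : a.degree < b.degree
    · exact ⟨0, by simpa using h⟩
    · have ha : a ≠ 0 := by rintro rfl; exact h (by simpa [bot_lt_iff_ne_bot] using hb)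
      have hle : b.natDegree ≤ a.natDegree := natDegree_le_natDegree (not_lt.1 h)
      have hc : a.leadingCoeff / b.leadingCoeff ≠ 0 :=
        div_ne_zero (leadingCoeff_ne_zero.2 ha) (leadingCoeff_ne_zero.2 hb)
      let c : K[X] := monomial (a.natDegree - b.natDegree) (a.leadingCoeff / b.leadingCoeff)
      have hlt : (a - comp b c).degree < a.degree := by
        refine degree_sub_comp_lt ha ?_ ?_
        · rw [natDegree_monomial_eq _ hc]; omega
        · rw [leadingCoeff_monomial, mul_div_cancel₀ _ (leadingCoeff_ne_zero.2 hb)]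
      obtain ⟨q, hq⟩ := ih _ (hd ▸ hlt) _ rfl
      refine ⟨c + q, ?_⟩
      rwa [map_add, ← sub_sub]

theorem isLeftOre : IsLeftOre (DiffOp K) :=
  isLeftOre_of_division (fun P : DiffOp K => Polynomial.degree (R := K) P)
    fun a _ hb => exists_degree_sub_comp_left_lt (K := K) a hb

theorem isRightOre : IsRightOre (DiffOp K) :=
  isRightOre_of_division (fun P : DiffOp K => Polynomial.degree (R := K) P)
    fun a _ hb => exists_degree_sub_comp_right_lt (K := K) a hb

end DiffOp

theorem isControllable_iff_isParametrizable_diffOp {K : Type u} [Field K] [Differential K]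
    {p m : ℕ} (R : Matrix (Fin p) (Fin m) (DiffOp K)) :
    IsControllable R ↔ IsParametrizable R :=
  ⟨fun h => h.isParametrizable DiffOp.isLeftOre DiffOp.isRightOre, fun h => h.isControllable⟩

/-! ### Smooth functions as an `ℝ[X]`-module. -/

noncomputable section

/-- The space of smooth functions of time. -/
def smoothFun : Submodule ℝ (ℝ → ℝ) where
  carrier := {f | ContDiff ℝ ∞ f}
  zero_mem' := (contDiff_const : ContDiff ℝ ∞ fun _ : ℝ => (0 : ℝ))
  add_mem' {f g} (hf : ContDiff ℝ ∞ f) (hg : ContDiff ℝ ∞ g) := hf.add hg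
  smul_mem' c f (hf : ContDiff ℝ ∞ f) := hf.const_smul c

namespace smoothFun

theorem contDiff (f : smoothFun) : ContDiff ℝ ∞ (f : ℝ → ℝ) := f.2

theorem differentiable (f : smoothFun) : Differentiable ℝ (f : ℝ → ℝ) :=
  (contDiff f).differentiable (by simp)

/-- The derivation `d/dt` of smooth functions. -/
def derivation : Module.End ℝ smoothFun where
  toFun f := ⟨deriv f, (contDiff_infty_iff_deriv.1 f.2).2⟩
  map_add' f g := Subtype.ext <| funext fun t =>
    deriv_add (smoothFun.differentiable f t) (smoothFun.differentiable g t)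
  map_smul' c f := Subtype.ext <| funext fun t => deriv_const_smul c (smoothFun.differentiable f t)

@[simp] theorem coe_derivation (f : smoothFun) : (derivation f : ℝ → ℝ) = deriv f := rfl

theorem coe_derivation_pow (n : ℕ) (f : smoothFun) :
    ((derivation ^ n) f : ℝ → ℝ) = iteratedDeriv n f := by
  induction n with
  | zero => simp
  | succ n ih => rw [pow_succ', Module.End.mul_apply, coe_derivation, ih, iteratedDeriv_succ]

theorem coe_aeval (P : ℝ[X]) (f : smoothFun) :
    (aeval derivation P f : ℝ → ℝ) = applyOp P f := by
  funext t
  simp only [applyOp, aeval_def, eval₂_eq_sum, Polynomial.sum_def, LinearMap.sum_apply,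
    Submodule.coe_sum, Finset.sum_apply]
  refine Finset.sum_congr rfl fun i _ => ?_
  rw [← coe_derivation_pow]; rfl

/-- The action of a row of operators on a vector of smooth functions. -/
def pair {m : ℕ} (r : Fin m → ℝ[X]) (w : Fin m → smoothFun) : smoothFun :=
  ∑ j, aeval derivation (r j) (w j)

variable {m l p : ℕ}

theorem coe_pair (R : Matrix (Fin p) (Fin m) ℝ[X]) (w : Fin m → smoothFun) (i : Fin p) :
    (pair (R i) w : ℝ → ℝ) = applyMat R (fun j => (w j : ℝ → ℝ)) i := by
  funext t
  simp [pair, applyMat, coe_aeval]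

theorem pair_add (r s : Fin m → ℝ[X]) (w : Fin m → smoothFun) :
    pair (r + s) w = pair r w + pair s w := by
  simp [pair, Finset.sum_add_distrib]

theorem pair_zero (w : Fin m → smoothFun) : pair 0 w = 0 := by simp [pair]

theorem pair_zero_right (r : Fin m → ℝ[X]) : pair r 0 = 0 := by simp [pair]

theorem pair_smul (P : ℝ[X]) (r : Fin m → ℝ[X]) (w : Fin m → smoothFun) :
    pair (P • r) w = aeval derivation P (pair r w) := by
  simp [pair, map_mul]

theorem pair_sum {ι : Type*} (s : Finset ι) (r : ι → Fin m → ℝ[X]) (w : Fin m → smoothFun) :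
    pair (∑ i ∈ s, r i) w = ∑ i ∈ s, pair (r i) w := by
  classical
  induction s using Finset.induction_on with
  | empty => simp [pair_zero]
  | insert a s ha ih => rw [Finset.sum_insert ha, Finset.sum_insert ha, pair_add, ih]

theorem pair_vecMul (r : Fin m → ℝ[X]) (D : Matrix (Fin m) (Fin l) ℝ[X])
    (ξ : Fin l → smoothFun) : pair (Matrix.vecMul r D) ξ = pair r fun j => pair (D j) ξ := by
  rw [Matrix.vecMul_eq_sum, pair_sum]
  simp only [pair_smul]
  rfl

theorem pair_eq_zero_of_mem_span {R : Matrix (Fin p) (Fin m) ℝ[X]} {w : Fin m → smoothFun}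
    (hw : ∀ i, pair (R i) w = 0) {r : Fin m → ℝ[X]}
    (hr : r ∈ Submodule.span ℝ[X] (Set.range R.row)) : pair r w = 0 := by
  induction hr using Submodule.span_induction with
  | mem x hx => obtain ⟨i, rfl⟩ := hx; exact hw i
  | zero => exact pair_zero w
  | add x y _ _ hx hy => rw [pair_add, hx, hy, add_zero]
  | smul a x _ hx => rw [pair_smul, hx, map_zero]

theorem mem_trajectories_iff (R : Matrix (Fin p) (Fin m) ℝ[X]) (w : Fin m → smoothFun) :
    (fun j => (w j : ℝ → ℝ)) ∈ trajectories R ↔ ∀ i, pair (R i) w = 0 := by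
  constructor
  · rintro ⟨_, h⟩ i
    exact Subtype.ext ((coe_pair R w i).trans (congrFun h i))
  · intro h
    exact ⟨fun j => contDiff (w j), funext fun i => by rw [← coe_pair, h i]; rfl⟩

theorem exists_lift {w : Fin m → ℝ → ℝ} (hw : ∀ j, ContDiff ℝ ∞ (w j)) :
    ∃ v : Fin m → smoothFun, w = fun j => (v j : ℝ → ℝ) :=
  ⟨fun j => ⟨w j, hw j⟩, rfl⟩

/-- Operators are local. -/
theorem pair_congr_of_eventuallyEq (r : Fin m → ℝ[X]) {v w : Fin m → smoothFun} {t : ℝ}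
    (h : ∀ j, (v j : ℝ → ℝ) =ᶠ[nhds t] w j) :
    (pair r v : ℝ → ℝ) t = (pair r w : ℝ → ℝ) t := by
  simp only [pair, Submodule.coe_sum, Finset.sum_apply, coe_aeval, applyOp]
  refine Finset.sum_congr rfl fun j _ => ?_
  simp only [(h j).iteratedDeriv_eq]

/-- The time shift of a smooth function. -/
def shift (T : ℝ) (f : smoothFun) : smoothFun :=
  ⟨fun t => (f : ℝ → ℝ) (t - T), (contDiff f).comp (contDiff_id.sub contDiff_const)⟩

/-- Operators with constant coefficients commute with time shifts. -/
theorem pair_shift (r : Fin m → ℝ[X]) (w : Fin m → smoothFun) (T t : ℝ) :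
    (pair r (fun j => shift T (w j)) : ℝ → ℝ) t = (pair r w : ℝ → ℝ) (t - T) := by
  simp only [pair, Submodule.coe_sum, Finset.sum_apply, coe_aeval, applyOp, shift]
  refine Finset.sum_congr rfl fun j _ => ?_
  simp only [iteratedDeriv_comp_sub_const]

/-! ### Smooth functions detect nonzero elements of finitely generated modules. -/

/-- Every vector of a finite-dimensional `ℝ[X]`-module is detected by a homomorphism into the
smooth functions. -/
theorem exists_hom_of_finite {F : Type*} [AddCommGroup F] [Module ℝ F] [Module ℝ[X] F]
    [IsScalarTower ℝ ℝ[X] F] [Module.Finite ℝ F] {z : F} (hz : z ≠ 0) :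
    ∃ W : F →ₗ[ℝ] smoothFun, (∀ (P : ℝ[X]) (f : F), W (P • f) = aeval derivation P (W f)) ∧
      W z ≠ 0 := by
  let e := (Module.finBasis ℝ F).equivFun
  obtain ⟨i, hi⟩ : ∃ i, e z i ≠ 0 := by
    by_contra! h
    exact hz (e.map_eq_zero_iff.1 (funext h))
  let T₀ : F →ₗ[ℝ] F := (Algebra.lsmul ℝ ℝ F (X : ℝ[X]))
  let T := LinearMap.toContinuousLinearMap (e.toLinearMap ∘ₗ T₀ ∘ₗ e.symm.toLinearMap)
  have hT : ∀ f, T (e f) = e ((X : ℝ[X]) • f) := fun f => by simp [T, T₀]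
  -- A coordinate of the flow of `x' = T x`, where `T` is multiplication by `X`: differentiation in
  -- `t` becomes the action of `X`, and `t = 0` returns coordinate `i`, nonzero at `z`.
  let g : F → ℝ → ℝ := fun f t => NormedSpace.exp (t • T) (e f) i
  have hg : ∀ f t, HasDerivAt (g f) (g ((X : ℝ[X]) • f) t) t := fun f t => by
    have h := (hasDerivAt_exp_smul_const (𝕂 := ℝ) T t).clm_apply (hasDerivAt_const t (e f))
    have h2 := (hasDerivAt_pi.1 h) i
    simpa [g, ← hT] using h2
  have hg' : ∀ f, deriv (g f) = g ((X : ℝ[X]) • f) := fun f => funext fun t => (hg f t).deriv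
  have hsm : ∀ n : ℕ, ∀ f, ContDiff ℝ n (g f) := by
    intro n
    induction n with
    | zero =>
      intro f
      rw [Nat.cast_zero, contDiff_zero]
      exact Differentiable.continuous fun t => (hg f t).differentiableAt
    | succ n ih =>
      intro f
      rw [Nat.cast_succ, contDiff_succ_iff_deriv]
      exact ⟨fun t => (hg f t).differentiableAt, by simp, by rw [hg']; exact ih _⟩
  let W : F →ₗ[ℝ] smoothFun :=
    { toFun := fun f => ⟨g f, contDiff_infty.2 fun n => hsm n f⟩
      map_add' := fun a b => Subtype.ext <| funext fun t => by simp [g]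
      map_smul' := fun c a => Subtype.ext <| funext fun t => by simp [g] }
  have hX : ∀ f, W ((X : ℝ[X]) • f) = derivation (W f) := fun f =>
    Subtype.ext (hg' f).symm
  refine ⟨W, fun P => ?_, fun h => hi ?_⟩
  · induction P using Polynomial.induction_on with
    | C a => intro f; rw [aeval_C, ← algebraMap_eq, algebraMap_smul, map_smul]; rfl
    | add P Q hP hQ => intro f; rw [add_smul, map_add, hP, hQ, map_add, LinearMap.add_apply]
    | monomial n a ih =>
      intro f
      rw [pow_succ, ← mul_assoc, mul_smul, ih, hX,
        map_mul (aeval derivation) (C a * X ^ n), aeval_X, Module.End.mul_apply]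
  · have h0 := congrFun (congrArg Subtype.val h) 0
    simpa [W, g] using h0

/-- Over `ℝ[X]`, finitely generated modules are residually finite-dimensional. -/
theorem exists_ideal_not_mem_smul_top {M : Type*} [AddCommGroup M] [Module ℝ[X] M]
    [Module.Finite ℝ[X] M] {z : M} (hz : z ≠ 0) :
    ∃ I : Ideal ℝ[X], I ≠ ⊥ ∧ z ∉ I • (⊤ : Submodule ℝ[X] M) := by
  -- Krull intersection: if `z` lay in every `I ^ i • ⊤`, then `r • z = z` for some `r ∈ I`, so `1 -
  -- r` would annihilate `z` and lie in `I`.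
  obtain ⟨I, hI, hle⟩ := Ideal.exists_le_maximal (Ideal.torsionOf ℝ[X] M z)
    (by rwa [Ne, Ideal.torsionOf_eq_top_iff])
  have hI0 : I ≠ ⊥ := Ring.ne_bot_of_isMaximal_of_not_isField hI
    (Polynomial.not_isField ℝ)
  by_contra! h
  have hmem : z ∈ (⨅ i : ℕ, I ^ i • ⊤ : Submodule ℝ[X] M) :=
    (Submodule.mem_iInf _).2 fun i => h _ (pow_ne_zero i hI0)
  obtain ⟨r, hr⟩ := (I.mem_iInf_smul_pow_eq_bot_iff z).1 hmem
  have h1 : (1 - (r : ℝ[X])) ∈ I := hle <| by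
    rw [Ideal.mem_torsionOf_iff, sub_smul, one_smul, sub_eq_zero]; exact hr.symm
  exact hI.ne_top ((Ideal.eq_top_iff_one I).2 (by simpa using I.add_mem h1 r.2))

theorem finite_quotient_of_ne_bot {I : Ideal ℝ[X]} (hI : I ≠ ⊥) :
    Module.Finite ℝ (ℝ[X] ⧸ I) := by
  obtain ⟨q, rfl⟩ := (IsPrincipalIdealRing.principal I).principal
  have hq : q ≠ 0 := by rintro rfl; exact hI (by simp)
  exact (AdjoinRoot.powerBasis hq).finite

/-- The smooth functions cogenerate the finitely generated `ℝ[X]`-modules. -/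
theorem exists_pair_ne_zero (N : Submodule ℝ[X] (Fin m → ℝ[X])) {r : Fin m → ℝ[X]}
    (hr : r ∉ N) :
    ∃ w : Fin m → smoothFun, (∀ n ∈ N, pair n w = 0) ∧ pair r w ≠ 0 := by
  let M := (Fin m → ℝ[X]) ⧸ N
  have hz : (Submodule.Quotient.mk r : M) ≠ 0 := by rwa [Ne, Submodule.Quotient.mk_eq_zero]
  obtain ⟨I, hI, hzI⟩ := exists_ideal_not_mem_smul_top hz
  let F := M ⧸ (I • (⊤ : Submodule ℝ[X] M))
  have := finite_quotient_of_ne_bot hI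
  have : Module.Finite ℝ F := Module.Finite.trans (ℝ[X] ⧸ I) F
  obtain ⟨W, hW, hWz⟩ := exists_hom_of_finite (F := F)
    (z := Submodule.Quotient.mk (Submodule.Quotient.mk r)) (by rwa [Ne, Submodule.Quotient.mk_eq_zero])
  let π : (Fin m → ℝ[X]) →ₗ[ℝ[X]] F := Submodule.mkQ _ ∘ₗ Submodule.mkQ N
  -- A homomorphism out of the quotient by `N` amounts to a trajectory, namely the images of the
  -- basis vectors.
  have key : ∀ s, pair s (fun j => W (π (Pi.single j 1))) = W (π s) := fun s => by
    conv_rhs => rw [← Finset.univ_sum_single s]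
    simp only [map_sum, pair]
    refine Finset.sum_congr rfl fun j _ => ?_
    rw [← hW, ← map_smul, ← Pi.single_smul, smul_eq_mul, mul_one]
  refine ⟨_, fun n hn => ?_, by rw [key]; exact hWz⟩
  rw [key, show π n = 0 by
    rw [LinearMap.comp_apply, Submodule.mkQ_apply N, (Submodule.Quotient.mk_eq_zero N).2 hn,
      map_zero], map_zero]

end smoothFun

end

/-! ### Trajectories versus torsion. -/

noncomputable section

namespace smoothFun

variable {m l p : ℕ}

/-- A solution of a nontrivial scalar linear ODE that vanishes near some time is zero. -/
theorem eq_zero_of_aeval_eq_zero {P : ℝ[X]} (hP : P ≠ 0) {y : smoothFun}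
    (hy : aeval derivation P y = 0) {t₀ : ℝ} (h0 : (y : ℝ → ℝ) =ᶠ[nhds t₀] 0) : y = 0 := by
  let n := P.natDegree
  -- The extra factor `X` makes the order positive, so that the state vector `Y` has a component 0
  -- even when `P` is constant.
  let Q := P * X
  have hQ : Q.natDegree = n + 1 := natDegree_mul_X hP
  have hc : Q.coeff (n + 1) ≠ 0 := by
    rw [← hQ]; exact leadingCoeff_ne_zero.2 (mul_ne_zero hP X_ne_zero)
  have hrel : ∀ t, Q.coeff (n + 1) * iteratedDeriv (n + 1) (y : ℝ → ℝ) t =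
      -∑ j : Fin (n + 1), Q.coeff j * iteratedDeriv j (y : ℝ → ℝ) t := fun t => by
    have h1 : aeval derivation Q y = 0 := by
      rw [show Q = X * P from mul_comm _ _, map_mul, Module.End.mul_apply, hy, map_zero]
    have h2 : applyOp Q y t = 0 := by rw [← coe_aeval, h1]; rfl
    rw [applyOp, sum_over_range _ (by simp), hQ, Finset.sum_range_succ, Finset.sum_range] at h2
    exact eq_neg_of_add_eq_zero_right h2
  -- Companion matrix of `Q`.
  let L : (Fin (n + 1) → ℝ) →ₗ[ℝ] (Fin (n + 1) → ℝ) :=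
    LinearMap.pi fun i => if h : (i : ℕ) + 1 < n + 1 then LinearMap.proj ⟨i + 1, h⟩ else
      (Q.coeff (n + 1))⁻¹ • -∑ j : Fin (n + 1), Q.coeff j • LinearMap.proj j
  let Y : ℝ → Fin (n + 1) → ℝ := fun t i => iteratedDeriv i (y : ℝ → ℝ) t
  have hLY : ∀ t i, L (Y t) i = iteratedDeriv (i + 1) (y : ℝ → ℝ) t := fun t i => by
    simp only [L, LinearMap.pi_apply]
    split_ifs with h
    · rfl
    · rw [show (i : ℕ) = n by omega, eq_comm, ← inv_mul_cancel_left₀ hc (iteratedDeriv _ _ t),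
        hrel t]
      simp [Y]
  have hY : ∀ t, HasDerivAt Y (L.toContinuousLinearMap (Y t)) t := fun t =>
    hasDerivAt_pi.2 fun i => by
      have h1 : Differentiable ℝ (iteratedDeriv i (y : ℝ → ℝ)) := by
        rw [← coe_derivation_pow]; exact differentiable _
      change HasDerivAt (iteratedDeriv i (y : ℝ → ℝ)) (L (Y t) i) t
      rw [hLY, iteratedDeriv_succ]
      exact (h1 t).hasDerivAt
  have hY0 : Y = fun _ => 0 := by
    refine ODE_solution_unique_univ (v := fun _ => L.toContinuousLinearMap)
      (s := fun _ => Set.univ) (t₀ := t₀)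
      (fun _ => L.toContinuousLinearMap.lipschitz.lipschitzOnWith)
      (fun t => ⟨hY t, trivial⟩) (fun t => ⟨?_, trivial⟩) ?_
    · rw [map_zero]; exact hasDerivAt_const t _
    · funext i
      change iteratedDeriv i (y : ℝ → ℝ) t₀ = 0
      rw [h0.iteratedDeriv_eq]
      simp
  refine Subtype.ext (funext fun t => ?_)
  exact congrFun (congrFun hY0 t) 0

theorem pair_single (w : Fin m → smoothFun) (i : Fin m) :
    pair (Pi.single i 1) w = w i := by
  rw [pair, Finset.sum_eq_single i]
  · simp
  · intro j _ hj; simp [Pi.single_eq_of_ne hj]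
  · simp

end smoothFun

open smoothFun

variable {m l p : ℕ}

/-- Steer a trajectory detecting `r` to zero. Along the steered trajectory the observable `r` solves
`P y = 0` and vanishes after `T`, hence always; so it vanishes on the original past, hence on the
original trajectory. -/
theorem IsSteerable.isControllable {R : Matrix (Fin p) (Fin m) ℝ[X]} (h : IsSteerable R) :
    IsControllable R := by
  refine (isControllable_iff R).2 fun P r hP hr => ?_
  by_contra hrN
  obtain ⟨w, hw, hrw⟩ := exists_pair_ne_zero _ hrN
  have hw' : ∀ i, pair (R i) w = 0 := fun i => hw _ (Submodule.subset_span ⟨i, rfl⟩)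
  obtain ⟨T, hT, v, hv, hpast, hfuture⟩ := h _ ((mem_trajectories_iff R w).2 hw') _
    ((mem_trajectories_iff R 0).2 fun i => pair_zero_right _)
  obtain ⟨v, rfl⟩ := exists_lift hv.1
  rw [mem_trajectories_iff] at hv
  have hv0 : pair r v = 0 := by
    -- `T + 1`, and `-1` below, are interior to the half-lines of agreement, as locality of
    -- operators requires.
    refine eq_zero_of_aeval_eq_zero hP (t₀ := T + 1) ?_ ?_
    · rw [← pair_smul, pair_eq_zero_of_mem_span hv hr]
    · filter_upwards [lt_mem_nhds (show T < T + 1 by linarith)] with t ht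
      have h1 := pair_congr_of_eventuallyEq r (v := v) (w := 0) (t := t) fun j => by
        filter_upwards [lt_mem_nhds ht] with s hs using hfuture j s hs.le
      rw [h1, pair_zero_right]; rfl
  refine hrw (eq_zero_of_aeval_eq_zero hP (t₀ := -1) ?_ ?_)
  · rw [← pair_smul, pair_eq_zero_of_mem_span hw' hr]
  · filter_upwards [gt_mem_nhds (show (-1 : ℝ) < 0 by norm_num)] with t ht
    have h1 := pair_congr_of_eventuallyEq r (v := v) (w := w) (t := t) fun j => by
      filter_upwards [gt_mem_nhds ht] with s hs using hpast j s hs.le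
    rw [← h1, hv0]; rfl

theorem parametrizesTrajectories_iff {R : Matrix (Fin p) (Fin m) ℝ[X]}
    {D : Matrix (Fin m) (Fin l) ℝ[X]} :
    ParametrizesTrajectories R D ↔ ∀ w : Fin m → smoothFun,
      (∀ i, pair (R i) w = 0) ↔ ∃ ξ : Fin l → smoothFun, w = fun j => pair (D j) ξ := by
  have key : ∀ w : Fin m → smoothFun, (fun j => (w j : ℝ → ℝ)) ∈
      {η | ∃ ξ : Fin l → ℝ → ℝ, (∀ k, ContDiff ℝ ∞ (ξ k)) ∧ η = applyMat D ξ} ↔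
      ∃ ξ : Fin l → smoothFun, w = fun j => pair (D j) ξ := fun w => by
    constructor
    · rintro ⟨ξ, hξ, h⟩
      obtain ⟨ξ, rfl⟩ := exists_lift hξ
      exact ⟨ξ, funext fun j => Subtype.ext ((congrFun h j).trans (coe_pair D ξ j).symm)⟩
    · rintro ⟨ξ, rfl⟩
      exact ⟨_, fun k => contDiff (ξ k), funext fun j => coe_pair D ξ j⟩
  constructor
  · intro h w
    rw [← mem_trajectories_iff, h, key]
  · intro h
    ext η
    constructor
    · intro hη
      obtain ⟨w, rfl⟩ := exists_lift hη.1
      rwa [key, ← h, ← mem_trajectories_iff]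
    · rintro ⟨ξ, hξ, rfl⟩
      obtain ⟨ξ, rfl⟩ := exists_lift hξ
      have h1 := (mem_trajectories_iff R _).2 ((h _).2 ⟨ξ, rfl⟩)
      simpa only [coe_pair] using h1

/-- `P • r` kills every `D ξ`, so `P • (r D)` kills all smooth `ξ` and is zero. Cancelling `P` gives
`r D = 0`, so `r` kills all trajectories and lies in the row module. -/
theorem ParametrizesTrajectories.isControllable {R : Matrix (Fin p) (Fin m) ℝ[X]}
    {D : Matrix (Fin m) (Fin l) ℝ[X]} (h : ParametrizesTrajectories R D) :
    IsControllable R := by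
  rw [parametrizesTrajectories_iff] at h
  refine (isControllable_iff R).2 fun P r hP hr => ?_
  have hrD : Matrix.vecMul r D = 0 := by
    refine (smul_eq_zero.1 ?_ : P = 0 ∨ Matrix.vecMul r D = 0).resolve_left hP
    by_contra hne
    obtain ⟨ξ, -, hξ⟩ := exists_pair_ne_zero (⊥ : Submodule ℝ[X] (Fin l → ℝ[X]))
      (r := P • Matrix.vecMul r D) (by simpa using hne)
    rw [← Matrix.smul_vecMul, pair_vecMul] at hξ
    exact hξ (pair_eq_zero_of_mem_span ((h _).2 ⟨ξ, rfl⟩) hr)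
  by_contra hrN
  obtain ⟨w, hw, hrw⟩ := exists_pair_ne_zero _ hrN
  obtain ⟨ξ, rfl⟩ := (h w).1 fun i => hw _ (Submodule.subset_span ⟨i, rfl⟩)
  rw [← pair_vecMul, hrD, pair_zero] at hrw
  exact hrw rfl

/-- A controllable system with constant coefficients has a parametrization with a left inverse
modulo the equations of the system. -/
theorem IsControllable.exists_generatesCC_section {R : Matrix (Fin p) (Fin m) ℝ[X]}
    (h : IsControllable R) :
    ∃ (l : ℕ) (D : Matrix (Fin m) (Fin l) ℝ[X]) (S : Matrix (Fin l) (Fin m) ℝ[X]),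
      GeneratesCC R D ∧ ∀ r : Fin m → ℝ[X],
        r - Matrix.vecMul (Matrix.vecMul r D) S ∈ Submodule.span ℝ[X] (Set.range R.row) := by
  have : Module.IsTorsionFree ℝ[X] (Observable R) := .of_smul_eq_zero fun P z hz =>
    or_iff_not_imp_left.2 fun hP => h z ⟨P, hP, hz⟩
  let f := (Module.finBasis ℝ[X] (Observable R)).equivFun.toLinearMap ∘ₗ
    (Submodule.span ℝ[X] (Set.range R.row)).mkQ
  have hf : ∀ r, f r = 0 ↔ r ∈ Submodule.span ℝ[X] (Set.range R.row) := fun r => by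
    rw [LinearMap.comp_apply, LinearEquiv.coe_coe, LinearEquiv.map_eq_zero_iff,
      Submodule.mkQ_apply, Submodule.Quotient.mk_eq_zero]
  have hsurj : Function.Surjective f :=
    (Module.finBasis ℝ[X] (Observable R)).equivFun.surjective.comp (Submodule.mkQ_surjective _)
  -- The coordinate map `f` onto a free module splits; its section gives `S`.
  obtain ⟨g, hg⟩ := Module.projective_lifting_property f LinearMap.id hsurj
  refine ⟨_, LinearMap.toMatrixRight' f, LinearMap.toMatrixRight' g, fun r => ?_, fun r => ?_⟩
  · rw [Matrix.vecMul_toMatrixRight', hf]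
  · rw [← hf, Matrix.vecMul_toMatrixRight', Matrix.vecMul_toMatrixRight', map_sub, sub_eq_zero]
    exact (LinearMap.congr_fun hg (f r)).symm

/-- On a trajectory `w` the rows `eᵢ - eᵢ D S` vanish, so `w = D (S w)` and `ξ = S w` is a
potential. -/
theorem IsControllable.exists_parametrization {R : Matrix (Fin p) (Fin m) ℝ[X]}
    (h : IsControllable R) :
    ∃ (l : ℕ) (D : Matrix (Fin m) (Fin l) ℝ[X]), ParametrizesTrajectories R D := by
  obtain ⟨l, D, S, hD, hS⟩ := h.exists_generatesCC_section
  refine ⟨l, D, parametrizesTrajectories_iff.2 fun w => ⟨fun hw => ?_, ?_⟩⟩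
  · refine ⟨fun k => pair (S k) w, funext fun i => ?_⟩
    have h1 := pair_eq_zero_of_mem_span hw (hS (Pi.single i 1))
    rw [sub_eq_add_neg, pair_add, ← neg_one_smul ℝ[X], pair_smul, pair_vecMul, pair_vecMul,
      pair_single, pair_single] at h1
    simpa [add_neg_eq_zero] using h1
  · rintro ⟨ξ, rfl⟩ i
    rw [← pair_vecMul, (hD (R i)).2 (Submodule.subset_span ⟨i, rfl⟩), pair_zero]

theorem ParametrizesTrajectories.isSteerable {R : Matrix (Fin p) (Fin m) ℝ[X]}
    {D : Matrix (Fin m) (Fin l) ℝ[X]} (h : ParametrizesTrajectories R D) : IsSteerable R := by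
  rw [parametrizesTrajectories_iff] at h
  intro w₁ h₁ w₂ h₂
  obtain ⟨w₁, rfl⟩ := exists_lift h₁.1
  obtain ⟨w₂, rfl⟩ := exists_lift h₂.1
  rw [mem_trajectories_iff, h] at h₁ h₂
  obtain ⟨ξ₁, rfl⟩ := h₁
  obtain ⟨ξ₂, rfl⟩ := h₂
  -- `χ` is 0 up to time 1 and 1 from time 2 on. With `T = 3` this leaves room for `ξ` to agree with
  -- `ξ₁`, or with the shifted `ξ₂`, on a neighbourhood of each `t ≤ 0`, or `t ≥ 3`.
  let χ : ℝ → ℝ := fun t => Real.smoothTransition (t - 1)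
  have hχ : ContDiff ℝ ∞ χ := Real.smoothTransition.contDiff.comp (contDiff_id.sub contDiff_const)
  let ξ : Fin l → smoothFun := fun k =>
    ⟨fun t => (1 - χ t) * (ξ₁ k : ℝ → ℝ) t + χ t * (shift 3 (ξ₂ k) : ℝ → ℝ) t,
      ((contDiff_const.sub hχ).mul (contDiff _)).add (hχ.mul (contDiff _))⟩
  refine ⟨3, by norm_num, fun j => (pair (D j) ξ : ℝ → ℝ),
    (mem_trajectories_iff R _).2 ((h _).2 ⟨ξ, rfl⟩), fun j t ht => ?_, fun j t ht => ?_⟩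
  · refine pair_congr_of_eventuallyEq _ fun k => ?_
    filter_upwards [gt_mem_nhds (show t < 1 by linarith)] with s hs
    have : χ s = 0 := Real.smoothTransition.zero_of_nonpos (by linarith)
    simp [ξ, this]
  · refine Eq.trans ?_ (pair_shift (D j) ξ₂ 3 t)
    refine pair_congr_of_eventuallyEq _ fun k => ?_
    filter_upwards [lt_mem_nhds (show 2 < t by linarith)] with s hs
    have : χ s = 1 := Real.smoothTransition.one_of_one_le (by linarith)
    simp [ξ, this]

end

theorem theorem2p1 :
    (∀ (K : Type u) [Field K] [Differential K] (p m : ℕ)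
      (R : Matrix (Fin p) (Fin m) (DiffOp K)), IsControllable R ↔ IsParametrizable R) ∧
    (∀ (p m : ℕ) (R : Matrix (Fin p) (Fin m) ℝ[X]),
      List.TFAE [IsSteerable R,
        ∃ (l : ℕ) (D : Matrix (Fin m) (Fin l) ℝ[X]), ParametrizesTrajectories R D,
        IsControllable R,
        IsParametrizable R]) := by
  refine ⟨fun K _ _ p m R => isControllable_iff_isParametrizable_diffOp R, fun p m R => ?_⟩
  tfae_have 1 → 3 := IsSteerable.isControllable
  tfae_have 3 → 2 := IsControllable.exists_parametrization
  tfae_have 2 → 1 := fun ⟨_, _, h⟩ => h.isSteerable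
  tfae_have 2 → 3 := fun ⟨_, _, h⟩ => h.isControllable
  tfae_have 3 → 4 := fun h =>
    let ⟨l, D, _, hD, _⟩ := h.exists_generatesCC_section
    ⟨l, D, hD⟩
  tfae_have 4 → 3 := IsParametrizable.isControllable
  tfae_finish
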